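/- Let $d\ge 1$ be an integer, $\varepsilon>0$, $\delta\ge 0$. Let $\mathcal X$ be a set, let $\mathcal X^*=\bigcup_{n\ge 0}\mathcal X^n$ be the set of datasets, and call two datasets neighboring if they have the same size and differ in at most one entry. A mechanism $\mathcal M$ assigns to each dataset a random output; it is $(\varepsilon,\delta)$-DP if $\mathbb P[\mathcal M(D)\in S]\le e^{\varepsilon}\,\mathbb P[\mathcal M(D')\in S]+\delta$ for all neighboring $D,D'$ and all measurable sets $S$ of outputs. Let $\mathsf{BinMap}:[2^d]\to\{0,1\}^d$ be a bijection (for instance a binary representation), where $[2^d]=\{1,\dots,2^d\}$, and let $\widetilde M:\mathcal X^*\to[2^d]$ be an $(\varepsilon,\delta)$-DP mechanism. On a dataset $D$, let $u_{\mathrm{apx}}$ be the output of $\widetilde M(D)$, and obtain $u_{\mathrm{pure}}$ from it by the following algorithm, all of whose random choices are independent of each other and of $u_{\mathrm{apx}}$. 1. Put $z_{\mathrm{bin}}=\mathsf{BinMap}(u_{\mathrm{apx}})\in\{0,1\}^d\subseteq[0,1]^d$. 2. Put $\omega=2^{-d}$ and $\Delta=2R\,\bigl(\tfrac{\delta}{2\omega}\bigr)^{1/d}$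 with $R=\tfrac d2$, the $\ell_1$-radius of the cube $[0,1]^d$. 3. With probability $1-\omega$ put $x=z_{\mathrm{bin}}$; otherwise sample $x$ from the uniform distribution on $[0,1]^d$. 4. Put $z_{\mathrm{pure}}=x+y$, where the coordinates of $y\in\mathbb R^d$ are i.i.d. Laplace variables with mean $0$ and scale $2\Delta/\varepsilon$ (for $\delta=0$ the scale is $0$ and $y=0$). 5. Put $z_{\mathrm{round}}=\bigl(\mathbf 1((z_{\mathrm{pure}})_i\ge \tfrac12)\bigr)_{i=1}^d$ and output $u_{\mathrm{pure}}=\mathsf{BinMap}^{-1}(z_{\mathrm{round}})$. If $\delta<\dfrac{\varepsilon^d}{(2d)^{3d}}$, then the mechanism $D\mapsto u_{\mathrm{pure}}$ is $(2\varepsilon,0)$-DP, and for every dataset $D$ $$\mathbb P[u_{\mathrm{apx}}=u_{\mathrm{pure}}]>1-2^{-d}-\frac d2 e^{-d}.$$ -/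

import Mathlib

open MeasureTheory

namespace Purification

/-- The space `𝒳^* = ⋃ₙ 𝒳ⁿ` of finite datasets with entries in `X`. -/
abbrev Dataset (X : Type*) := Σ n : ℕ, (Fin n → X)

/-- Neighboring datasets: they have the same size and differ in at most one entry. -/
def Neighbor {X : Type*} (D D' : Dataset X) : Prop :=
  ∃ (n : ℕ) (x y : Fin n → X), D = ⟨n, x⟩ ∧ D' = ⟨n, y⟩ ∧ {i | x i ≠ y i}.Subsingleton

/-- `M`, which sends a dataset to the law of its random output, is an `(ε, δ)`-differentially
private mechanism. -/
structure IsDP {X Y : Type*} [MeasurableSpace Y] (M : Dataset X → Measure Y) (ε δ : ℝ) :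
    Prop where
  isProbabilityMeasure : ∀ D, IsProbabilityMeasure (M D)
  bound : ∀ D D', Neighbor D D' → ∀ S : Set Y, MeasurableSet S →
    (M D).real S ≤ Real.exp ε * (M D').real S + δ

/-- The centered Laplace distribution of scale `b`: density `x ↦ exp (-|x| / b) / (2 * b)` if
`0 < b`, and no noise (the point mass at `0`) for the degenerate scale `b = 0`. -/
noncomputable def laplace (b : ℝ) : Measure ℝ :=
  if 0 < b then volume.withDensity (fun x => ENNReal.ofReal (Real.exp (-|x| / b) / (2 * b)))
  else Measure.dirac 0

/-- `Laplace^{⊗ d}(b)`: `d` independent Laplace variables of scale `b`. -/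
noncomputable def laplaceVec (d : ℕ) (b : ℝ) : Measure (Fin d → ℝ) :=
  Measure.pi fun _ => laplace b

/-- The uniform distribution on a set `Θ ⊆ ℝ^d` (of positive finite volume). -/
noncomputable def unif {d : ℕ} (Θ : Set (Fin d → ℝ)) : Measure (Fin d → ℝ) :=
  (volume Θ)⁻¹ • volume.restrict Θ

/-- The bound `Δ = 2 d^{1 - 1/q} R (δ / (2ω))^{1/d}` to which the noise is calibrated. -/
noncomputable def noiseBound (d : ℕ) (q R δ ω : ℝ) : ℝ :=
  2 * (d : ℝ) ^ (1 - 1 / q) * R * (δ / (2 * ω)) ^ (1 / (d : ℝ))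

/-- Uniform mixing: the law of the point that equals `x` with probability `1 - ω` and is
otherwise sampled from `Unif(Θ)`. -/
noncomputable def mix {d : ℕ} (Θ : Set (Fin d → ℝ)) (ω : ℝ) (x : Fin d → ℝ) :
    Measure (Fin d → ℝ) :=
  ENNReal.ofReal (1 - ω) • Measure.dirac x + ENNReal.ofReal ω • unif Θ

/-- The continuous purification algorithm `𝒜_pure(x, Θ, ε', δ, ω)`, with `Θ` of `ℓ_q`-radius `R`:
the law of its output on input `x`. It mixes with the uniform distribution on `Θ` and then adds
independent Laplace noise of scale `2Δ/ε'` to each coordinate. -/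
noncomputable def aPure {d : ℕ} (q R : ℝ) (x : Fin d → ℝ) (Θ : Set (Fin d → ℝ))
    (ε' δ ω : ℝ) : Measure (Fin d → ℝ) :=
  Measure.conv (mix Θ ω x) (laplaceVec d (2 * noiseBound d q R δ ω / ε'))

/-- The finite output space `[2^d] = {1, …, 2^d}`. -/
abbrev Index (d : ℕ) := Set.Icc (1 : ℕ) (2 ^ d)

/-- The inclusion of `{0,1}^d` in `ℝ^d`. -/
def embed {d : ℕ} (z : Fin d → Fin 2) : Fin d → ℝ := fun i => ((z i : ℕ) : ℝ)

/-- Coordinatewise rounding `x ↦ (𝟏(xᵢ ≥ 1/2))ᵢ` from `ℝ^d` to `{0,1}^d`. -/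
noncomputable def round {d : ℕ} (x : Fin d → ℝ) : Fin d → Fin 2 :=
  fun i => if 1 / 2 ≤ x i then 1 else 0

/-- Binary embedding purification: the law of the output `u_pure` on input `u_apx = u`.
The index is encoded by the bijection `binMap`, purified on the cube `Θ = [0,1]^d` with `ε' = ε`
and `ω = 2^{-d}`, rounded coordinatewise and decoded. The cube is contained in the `ℓ_1`-ball of
radius `d/2` around its center, so that `q = 1` and `R = d/2`. -/
noncomputable def aPureDiscrete {d : ℕ} (binMap : Index d ≃ (Fin d → Fin 2)) (ε δ : ℝ)
    (u : Index d) : Measure (Index d) :=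
  (aPure 1 ((d : ℝ) / 2) (embed (binMap u)) (Set.Icc 0 1) ε δ ((2 : ℝ) ^ d)⁻¹).map
    fun z => binMap.symm (round z)

/-- The purified mechanism: the law of `u_pure`, where `u_apx` is the output of `M`. -/
noncomputable def purify {X : Type*} {d : ℕ} (binMap : Index d ≃ (Fin d → Fin 2)) (ε δ : ℝ)
    (M : Dataset X → Measure (Index d)) (D : Dataset X) : Measure (Index d) :=
  (M D).bind (aPureDiscrete binMap ε δ)

/-- The joint law of `(u_apx, u_pure)` on the dataset `D`. -/
noncomputable def jointLaw {X : Type*} {d : ℕ} (binMap : Index d ≃ (Fin d → Fin 2)) (ε δ : ℝ)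
    (M : Dataset X → Measure (Index d)) (D : Dataset X) : Measure (Index d × Index d) :=
  (M D).bind fun u => (aPureDiscrete binMap ε δ u).map fun v => (u, v)

end Purification

/-!
Write `ω = 2⁻ᵈ`. Decoding commutes with mixing, so the purified mechanism equals, with probability
`1 - ω`, an `(ε, δ)`-DP post-processing of the original mechanism and, with probability `ω`, an
output that does not depend on the dataset. For every `x`, the noisy point `x + y` rounds to the
same bits as `x` with probability at least `2⁻ᵈ`, so the second output takes each value with
probability at least `4⁻ᵈ`. This adds mass `ω 4⁻ᵈ = 8⁻ᵈ` to every nonempty event, and the additive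
error `δ` is absorbed by the factor `exp (2 * ε)` as soon as `δ ≤ (exp (2 * ε) - 1) 8⁻ᵈ`.

For the utility, a bit survives the noise unless a Laplace variable exceeds `1/2` in one
direction. When the scale is at most `1 / (2 * d)` this has probability at most `exp (-d) / 2`, and
Bernoulli's inequality handles the `d` bits together.
-/

namespace Purification

open Set Real

section Measure

variable {α β : Type*} [MeasurableSpace α] [MeasurableSpace β]

theorem measureReal_bind {μ : Measure α} {κ : α → Measure β} [∀ a, IsFiniteMeasure (κ a)]
    (hκ : Measurable κ) {s : Set β} (hs : MeasurableSet s) :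
    (μ.bind κ).real s = ∫ a, (κ a).real s ∂μ := by
  rw [measureReal_def, Measure.bind_apply hs hκ.aemeasurable]
  exact (integral_toReal ((Measure.measurable_coe hs).comp hκ).aemeasurable
    (ae_of_all _ fun a => measure_lt_top (κ a) s)).symm

theorem measurable_measureReal_apply {κ : α → Measure β} (hκ : Measurable κ) {s : Set β}
    (hs : MeasurableSet s) : Measurable fun a => (κ a).real s :=
  ((Measure.measurable_coe hs).comp hκ).ennreal_toReal

theorem le_measureReal_bind {μ : Measure α} [IsProbabilityMeasure μ] {κ : α → Measure β}
    [∀ a, IsProbabilityMeasure (κ a)] (hκ : Measurable κ) {s : Set β} (hs : MeasurableSet s)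
    {c : ℝ} (h : ∀ a, c ≤ (κ a).real s) : c ≤ (μ.bind κ).real s := by
  have hint : Integrable (fun a => (κ a).real s) μ :=
    .of_mem_Icc 0 1 (measurable_measureReal_apply hκ hs).aemeasurable
      (ae_of_all _ fun _ => ⟨measureReal_nonneg, measureReal_le_one⟩)
  calc c = ∫ _, c ∂μ := by simp
    _ ≤ ∫ a, (κ a).real s ∂μ := integral_mono (integrable_const c) hint h
    _ = (μ.bind κ).real s := (measureReal_bind hκ hs).symm

theorem mul_measureReal_le_conv {G : Type*} [AddMonoid G] [MeasurableSpace G] [MeasurableAdd₂ G]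
    {μ ν : Measure G} [IsFiniteMeasure μ] [IsFiniteMeasure ν] {s t : Set G}
    (ht : MeasurableSet t) {p : ℝ} (hp : 0 ≤ p) (h : ∀ x ∈ s, p ≤ ν.real ((x + ·) ⁻¹' t)) :
    p * μ.real s ≤ (μ ∗ ν).real t := by
  have hpre : MeasurableSet ((fun z : G × G => z.1 + z.2) ⁻¹' t) := measurable_add ht
  have hle : ENNReal.ofReal p * μ s ≤ (μ ∗ ν) t := by
    calc ENNReal.ofReal p * μ s
        ≤ ENNReal.ofReal p * μ {x | ENNReal.ofReal p ≤ ν ((x + ·) ⁻¹' t)} := by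
          gcongr
          exact fun x hx => (ENNReal.ofReal_le_iff_le_toReal (measure_ne_top _ _)).2 (h x hx)
      _ ≤ ∫⁻ x, ν ((x + ·) ⁻¹' t) ∂μ :=
          mul_meas_ge_le_lintegral (measurable_measure_prodMk_left hpre) _
      _ = (μ ∗ ν) t := by
          rw [Measure.conv, Measure.map_apply measurable_add ht, Measure.prod_apply hpre]
          rfl
  simpa [measureReal_def, ENNReal.toReal_mul, hp] using
    ENNReal.toReal_mono (measure_ne_top _ _) hle

/-- Both integrals are averages over `t ∈ [0,1]` of the measures of the superlevel sets
`{a | t ≤ f a}`. -/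
theorem integral_le_of_forall_measureReal_le {μ ν : Measure α} [IsFiniteMeasure μ]
    [IsFiniteMeasure ν] {c δ : ℝ} (h : ∀ s, MeasurableSet s → μ.real s ≤ c * ν.real s + δ)
    {f : α → ℝ} (hf : Measurable f) (hf01 : ∀ a, f a ∈ Icc 0 1) :
    ∫ a, f a ∂μ ≤ c * ∫ a, f a ∂ν + δ := by
  have layercake (ρ : Measure α) [IsFiniteMeasure ρ] :
      ∫ a, f a ∂ρ = ∫ t in (0 : ℝ)..1, ρ.real {a | t ≤ f a} := by
    rw [intervalIntegral.integral_of_le zero_le_one]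
    exact (Integrable.of_mem_Icc 0 1 hf.aemeasurable
      (ae_of_all _ hf01)).integral_eq_integral_Ioc_meas_le
        (ae_of_all _ fun a => (hf01 a).1) (ae_of_all _ fun a => (hf01 a).2)
  have hint (ρ : Measure α) [IsFiniteMeasure ρ] :
      IntervalIntegrable (fun t => ρ.real {a | t ≤ f a}) volume 0 1 :=
    Antitone.intervalIntegrable fun _ _ hst => measureReal_mono fun _ ha => hst.trans ha
  calc ∫ a, f a ∂μ = ∫ t in (0 : ℝ)..1, μ.real {a | t ≤ f a} := layercake μ
    _ ≤ ∫ t in (0 : ℝ)..1, (c * ν.real {a | t ≤ f a} + δ) :=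
        intervalIntegral.integral_mono_on zero_le_one (hint μ)
          (((hint ν).const_mul c).add intervalIntegrable_const)
          fun t _ => h _ (measurableSet_le measurable_const hf)
    _ = c * ∫ a, f a ∂ν + δ := by
        rw [intervalIntegral.integral_add ((hint ν).const_mul c) intervalIntegrable_const,
          intervalIntegral.integral_const_mul, ← layercake ν]
        simp

end Measure

section Mixture

variable {α β : Type*} [MeasurableSpace α] [MeasurableSpace β] {ω : ℝ}

/-- The mixture of `μ` and `ν` with weights `1 - ω` and `ω`, the law of a sample that is drawn
from `ν` with probability `ω` and from `μ` otherwise. It is meant for `0 ≤ ω ≤ 1`: negative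
weights are truncated to `0`. -/
noncomputable def mixture (ω : ℝ) (μ ν : Measure α) : Measure α :=
  ENNReal.ofReal (1 - ω) • μ + ENNReal.ofReal ω • ν

theorem mixture_real_apply (h0 : 0 ≤ ω) (h1 : ω ≤ 1) (μ ν : Measure α) [IsFiniteMeasure μ]
    [IsFiniteMeasure ν] (s : Set α) :
    (mixture ω μ ν).real s = (1 - ω) * μ.real s + ω * ν.real s := by
  rw [mixture, measureReal_add_apply (by simp [ENNReal.mul_eq_top])
      (by simp [ENNReal.mul_eq_top]), measureReal_ennreal_smul_apply,
    measureReal_ennreal_smul_apply, ENNReal.toReal_ofReal (sub_nonneg.2 h1),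
    ENNReal.toReal_ofReal h0]

theorem isProbabilityMeasure_mixture (h0 : 0 ≤ ω) (h1 : ω ≤ 1) (μ ν : Measure α)
    [IsProbabilityMeasure μ] [IsProbabilityMeasure ν] : IsProbabilityMeasure (mixture ω μ ν) := by
  constructor
  simp only [mixture, Measure.add_apply, Measure.smul_apply, measure_univ, smul_eq_mul, mul_one]
  rw [← ENNReal.ofReal_add (sub_nonneg.2 h1) h0, sub_add_cancel, ENNReal.ofReal_one]

theorem mixture_conv {G : Type*} [AddMonoid G] [MeasurableSpace G] [MeasurableAdd₂ G]
    (μ ν ρ : Measure G) [SFinite μ] [SFinite ν] [SFinite ρ] :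
    mixture ω μ ν ∗ ρ = mixture ω (μ ∗ ρ) (ν ∗ ρ) := by
  rw [mixture, Measure.add_conv, Measure.conv_smul_left, Measure.conv_smul_left, mixture]

theorem map_mixture {f : α → β} (hf : Measurable f) (μ ν : Measure α) :
    (mixture ω μ ν).map f = mixture ω (μ.map f) (ν.map f) := by
  rw [mixture, Measure.map_add _ _ hf, Measure.map_smul, Measure.map_smul, mixture]

theorem bind_mixture (μ : Measure α) [IsProbabilityMeasure μ] {κ : α → Measure β}
    (hκ : Measurable κ) (ν : Measure β) :
    μ.bind (fun a => mixture ω (κ a) ν) = mixture ω (μ.bind κ) ν := by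
  have hmix : Measurable fun a => mixture ω (κ a) ν :=
    Measure.measurable_of_measurable_coe _ fun s hs => by
      simpa [mixture] using
        (((Measure.measurable_coe hs).comp hκ).const_mul _).add_const _
  ext s hs
  rw [Measure.bind_apply hs hmix.aemeasurable]
  simp only [mixture, Measure.add_apply, Measure.smul_apply, smul_eq_mul]
  rw [lintegral_add_right _ measurable_const,
    lintegral_const_mul' _ _ ENNReal.ofReal_ne_top,
    Measure.bind_apply hs hκ.aemeasurable, lintegral_const, measure_univ, mul_one]

end Mixture

section DifferentialPrivacy

variable {X Y Z : Type*} [MeasurableSpace Y] [MeasurableSpace Z] {M : Dataset X → Measure Y}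
  {ε δ : ℝ}

theorem IsDP.bind (hM : IsDP M ε δ) {κ : Y → Measure Z} [∀ y, IsProbabilityMeasure (κ y)]
    (hκ : Measurable κ) : IsDP (fun D => (M D).bind κ) ε δ where
  isProbabilityMeasure D := by
    have := hM.isProbabilityMeasure D
    exact isProbabilityMeasure_bind hκ.aemeasurable (ae_of_all _ fun _ => inferInstance)
  bound D D' hDD' S hS := by
    have := hM.isProbabilityMeasure D
    have := hM.isProbabilityMeasure D'
    rw [measureReal_bind hκ hS, measureReal_bind hκ hS]
    exact integral_le_of_forall_measureReal_le (hM.bound D D' hDD')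
      (measurable_measureReal_apply hκ hS) fun _ => ⟨measureReal_nonneg, measureReal_le_one⟩

theorem IsDP.mixture_pure (hM : IsDP M ε δ) {ν : Measure Y} [IsProbabilityMeasure ν]
    {ε' ω p : ℝ} (hω0 : 0 ≤ ω) (hω1 : ω ≤ 1) (hε' : 0 ≤ ε') (hεε' : ε ≤ ε')
    (hν : ∀ S, MeasurableSet S → S.Nonempty → p ≤ ν.real S)
    (hδ : (1 - ω) * δ ≤ (exp ε' - 1) * (ω * p)) :
    IsDP (fun D => mixture ω (M D) ν) ε' 0 where
  isProbabilityMeasure D := by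
    have := hM.isProbabilityMeasure D
    exact isProbabilityMeasure_mixture hω0 hω1 (M D) ν
  bound D D' hDD' S hS := by
    have := hM.isProbabilityMeasure D
    have := hM.isProbabilityMeasure D'
    rcases S.eq_empty_or_nonempty with rfl | hne
    · simp
    have hexp : 0 ≤ exp ε' - 1 := sub_nonneg.2 (one_le_exp hε')
    have : 0 ≤ 1 - ω := sub_nonneg.2 hω1
    have habsorb : (1 - ω) * δ ≤ (exp ε' - 1) * (ω * ν.real S) := by
      refine hδ.trans ?_
      gcongr
      exact hν S hS hne
    rw [mixture_real_apply hω0 hω1, mixture_real_apply hω0 hω1, add_zero]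
    calc (1 - ω) * (M D).real S + ω * ν.real S
        ≤ (1 - ω) * (exp ε' * (M D').real S + δ) + ω * ν.real S := by
          gcongr
          exact (hM.bound D D' hDD' S hS).trans (by gcongr)
      _ = (1 - ω) * (exp ε' * (M D').real S) + (1 - ω) * δ + ω * ν.real S := by ring
      _ ≤ (1 - ω) * (exp ε' * (M D').real S) + (exp ε' - 1) * (ω * ν.real S)
            + ω * ν.real S := by gcongr
      _ = exp ε' * ((1 - ω) * (M D').real S + ω * ν.real S) := by ring

end DifferentialPrivacy

section Laplace

variable {b c m t : ℝ}

theorem laplace_zero : laplace 0 = Measure.dirac 0 := by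
  simp [laplace]

theorem laplace_Ici (hb : 0 < b) (hc : 0 ≤ c) :
    laplace b (Ici c) = ENNReal.ofReal (exp (-c / b) / 2) := by
  have hb' : -b⁻¹ < 0 := neg_neg_of_pos (inv_pos.2 hb)
  have hdensity : EqOn (fun x => ENNReal.ofReal (exp (-|x| / b) / (2 * b)))
      (fun x => ENNReal.ofReal (exp (-b⁻¹ * x) / (2 * b))) (Ioi c) := fun x hx => by
    simp only [abs_of_nonneg (hc.trans (mem_Ioi.1 hx).le)]
    congr 3
    ring
  rw [laplace, if_pos hb, withDensity_apply _ measurableSet_Ici,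
    setLIntegral_congr Ioi_ae_eq_Ici.symm, setLIntegral_congr_fun measurableSet_Ioi hdensity,
    ← ofReal_integral_eq_lintegral_ofReal ((integrableOn_exp_mul_Ioi hb' c).div_const _)
      (ae_of_all _ fun x => by positivity),
    integral_div, integral_exp_mul_Ioi hb' c]
  congr 1
  field_simp

theorem laplace_Iic (hb : 0 < b) (hc : c ≤ 0) :
    laplace b (Iic c) = ENNReal.ofReal (exp (c / b) / 2) := by
  have hb' : 0 < b⁻¹ := inv_pos.2 hb
  have hdensity : EqOn (fun x => ENNReal.ofReal (exp (-|x| / b) / (2 * b)))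
      (fun x => ENNReal.ofReal (exp (b⁻¹ * x) / (2 * b))) (Iic c) := fun x hx => by
    simp only [abs_of_nonpos ((mem_Iic.1 hx).trans hc)]
    congr 3
    ring
  rw [laplace, if_pos hb, withDensity_apply _ measurableSet_Iic,
    setLIntegral_congr_fun measurableSet_Iic hdensity,
    ← ofReal_integral_eq_lintegral_ofReal ((integrableOn_exp_mul_Iic hb' c).div_const _)
      (ae_of_all _ fun x => by positivity),
    integral_div, integral_exp_mul_Iic hb' c]
  congr 1
  field_simp

instance isProbabilityMeasure_laplace (b : ℝ) : IsProbabilityMeasure (laplace b) := by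
  by_cases hb : 0 < b
  · have : NullSingletonClass (laplace b) := by
      rw [laplace, if_pos hb]
      infer_instance
    constructor
    rw [← Iic_union_Ioi (a := (0 : ℝ)), measure_union (Iic_disjoint_Ioi le_rfl) measurableSet_Ioi,
      measure_congr (Ioi_ae_eq_Ici (μ := laplace b)), laplace_Iic hb le_rfl, laplace_Ici hb le_rfl,
      ← ENNReal.ofReal_add (by positivity) (by positivity)]
    norm_num
  · rw [laplace, if_neg hb]
    infer_instance

instance isProbabilityMeasure_laplaceVec (d : ℕ) (b : ℝ) :
    IsProbabilityMeasure (laplaceVec d b) := by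
  unfold laplaceVec
  infer_instance

theorem one_sub_exp_le_laplace_real_Iio (hb : 0 ≤ b) (hm : 0 < m) (h : b * t ≤ m) :
    1 - exp (-t) / 2 ≤ (laplace b).real (Iio m) := by
  rcases hb.eq_or_lt with rfl | hb
  · simp [laplace_zero, measureReal_def, hm, (exp_pos (-t)).le, div_nonneg]
  · rw [← compl_Ici, probReal_compl_eq_one_sub measurableSet_Ici, measureReal_def,
      laplace_Ici hb hm.le, ENNReal.toReal_ofReal (by positivity), neg_div]
    gcongr
    rwa [le_div_iff₀' hb]

theorem one_sub_exp_le_laplace_real_Ici_neg (hb : 0 ≤ b) (hm : 0 ≤ m) (h : b * t ≤ m) :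
    1 - exp (-t) / 2 ≤ (laplace b).real (Ici (-m)) := by
  rcases hb.eq_or_lt with rfl | hb
  · simp [laplace_zero, measureReal_def, hm, (exp_pos (-t)).le, div_nonneg]
  · have htail : (laplace b).real (Iio (-m)) ≤ exp (-t) / 2 := by
      refine (measureReal_mono Iio_subset_Iic_self).trans ?_
      rw [measureReal_def, laplace_Iic hb (neg_nonpos.2 hm),
        ENNReal.toReal_ofReal (by positivity), neg_div]
      gcongr
      rwa [le_div_iff₀' hb]
    rw [← compl_Iio, probReal_compl_eq_one_sub measurableSet_Iio]
    linarith

theorem pow_le_laplaceVec_real_pi {d : ℕ} {p : ℝ} (hp : 0 ≤ p) (s : Fin d → Set ℝ)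
    (h : ∀ i, p ≤ (laplace b).real (s i)) : p ^ d ≤ (laplaceVec d b).real (univ.pi s) := by
  rw [measureReal_def, laplaceVec, Measure.pi_pi, ENNReal.toReal_prod]
  calc p ^ d = ∏ _i : Fin d, p := by simp
    _ ≤ ∏ i, (laplace b (s i)).toReal := Finset.prod_le_prod (fun _ _ => hp) fun i _ => h i

end Laplace

section Rounding

variable {d : ℕ} {b t : ℝ}

theorem measurable_round : Measurable (round : (Fin d → ℝ) → Fin d → Fin 2) :=
  measurable_pi_lambda _ fun i => Measurable.ite
    (measurableSet_le measurable_const (measurable_pi_apply i)) measurable_const measurable_const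

theorem round_eq_round_iff {x y : Fin d → ℝ} :
    round x = round y ↔ ∀ i, 1 / 2 ≤ x i ↔ 1 / 2 ≤ y i := by
  refine funext_iff.trans (forall_congr' fun i => ?_)
  grind [round]

theorem round_embed (v : Fin d → Fin 2) : round (embed v) = v := by
  funext i
  obtain h | h : v i = 0 ∨ v i = 1 := by omega
  all_goals norm_num [round, embed, h]

theorem abs_embed_sub_half (v : Fin d → Fin 2) (i : Fin d) : |embed v i - 1 / 2| = 1 / 2 := by
  obtain h | h : v i = 0 ∨ v i = 1 := by omega
  all_goals norm_num [embed, h, abs_of_pos, abs_of_neg]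

theorem one_sub_exp_le_laplace_real_half_le_add_iff {x : ℝ} (hb : 0 ≤ b)
    (h : b * t ≤ |x - 1 / 2|) :
    1 - exp (-t) / 2 ≤ (laplace b).real {y | 1 / 2 ≤ x + y ↔ 1 / 2 ≤ x} := by
  rcases le_or_gt (1 / 2) x with hx | hx
  · have hset : {y | 1 / 2 ≤ x + y ↔ 1 / 2 ≤ x} = Ici (-(x - 1 / 2)) := by
      ext y
      simp only [hx, iff_true, mem_ofPred_eq, mem_Ici, neg_sub, sub_le_iff_le_add']
    rw [hset]
    rw [abs_of_nonneg (sub_nonneg.2 hx)] at h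
    exact one_sub_exp_le_laplace_real_Ici_neg hb (sub_nonneg.2 hx) h
  · have hset : {y | 1 / 2 ≤ x + y ↔ 1 / 2 ≤ x} = Iio (1 / 2 - x) := by
      ext y
      simp only [hx.not_ge, iff_false, not_le, mem_ofPred_eq, mem_Iio, lt_sub_iff_add_lt']
    rw [hset]
    rw [abs_of_neg (sub_neg.2 hx), neg_sub] at h
    exact one_sub_exp_le_laplace_real_Iio hb (sub_pos.2 hx) h

theorem pow_le_laplaceVec_real_round_add_eq {x : Fin d → ℝ} (hb : 0 ≤ b) (ht : 0 ≤ t)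
    (h : ∀ i, b * t ≤ |x i - 1 / 2|) :
    (1 - exp (-t) / 2) ^ d ≤ (laplaceVec d b).real {y | round (x + y) = round x} := by
  have hset : {y | round (x + y) = round x} =
      univ.pi fun i => {y | 1 / 2 ≤ x i + y ↔ 1 / 2 ≤ x i} := by
    ext y
    simp [round_eq_round_iff]
  have hexp : exp (-t) ≤ 1 := exp_le_one_iff.2 (neg_nonpos.2 ht)
  rw [hset]
  exact pow_le_laplaceVec_real_pi (by linarith) _ fun i =>
    one_sub_exp_le_laplace_real_half_le_add_iff hb (h i)

theorem pow_mul_le_conv_laplaceVec_real_round {μ : Measure (Fin d → ℝ)} [IsFiniteMeasure μ]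
    (hb : 0 ≤ b) (ht : 0 ≤ t) {s : Set (Fin d → ℝ)} {v : Fin d → Fin 2}
    (hround : ∀ x ∈ s, round x = v) (hmargin : ∀ x ∈ s, ∀ i, b * t ≤ |x i - 1 / 2|) :
    (1 - exp (-t) / 2) ^ d * μ.real s ≤ (μ ∗ laplaceVec d b).real (round ⁻¹' {v}) := by
  have hexp : exp (-t) ≤ 1 := exp_le_one_iff.2 (neg_nonpos.2 ht)
  refine mul_measureReal_le_conv (measurable_round (measurableSet_singleton v))
    (pow_nonneg (by linarith) d) fun x hx => ?_
  rw [← hround x hx]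
  exact pow_le_laplaceVec_real_round_add_eq hb ht (hmargin x hx)

theorem one_sub_le_conv_dirac_embed_real_round (hb : 0 ≤ b) (ht : 0 ≤ t) (h : b * t ≤ 1 / 2)
    (v : Fin d → Fin 2) :
    1 - d / 2 * exp (-t) ≤
      (Measure.dirac (embed v) ∗ laplaceVec d b).real (round ⁻¹' {v}) := by
  have hexp : exp (-t) ≤ 1 := exp_le_one_iff.2 (neg_nonpos.2 ht)
  calc 1 - d / 2 * exp (-t) = 1 + d * (-(exp (-t) / 2)) := by ring
    _ ≤ (1 + -(exp (-t) / 2)) ^ d := one_add_mul_le_pow (by linarith) d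
    _ = (1 - exp (-t) / 2) ^ d * (Measure.dirac (embed v)).real {embed v} := by
        simp [measureReal_def, sub_eq_add_neg]
    _ ≤ (Measure.dirac (embed v) ∗ laplaceVec d b).real (round ⁻¹' {v}) :=
        pow_mul_le_conv_laplaceVec_real_round hb ht
          (by rintro x rfl; exact round_embed v)
          (by rintro x rfl i; rwa [abs_embed_sub_half])

end Rounding

section Cube

variable {d : ℕ} {b : ℝ}

theorem unif_cube (d : ℕ) : unif (Icc (0 : Fin d → ℝ) 1) =
    Measure.pi fun _ => volume.restrict (Icc (0 : ℝ) 1) := by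
  have hvol : volume (Icc (0 : Fin d → ℝ) 1) = 1 := by simp [Real.volume_Icc_pi]
  rw [unif, hvol, inv_one, one_smul, ← pi_univ_Icc, volume_pi, Measure.restrict_pi_pi]
  rfl

instance isProbabilityMeasure_unif_cube (d : ℕ) :
    IsProbabilityMeasure (unif (Icc (0 : Fin d → ℝ) 1)) := by
  have : IsProbabilityMeasure (volume.restrict (Icc (0 : ℝ) 1)) := ⟨by simp⟩
  rw [unif_cube]
  infer_instance

theorem restrict_Icc_real_half_le_bit (w : Fin 2) :
    (volume.restrict (Icc (0 : ℝ) 1)).real {x | (if 1 / 2 ≤ x then 1 else 0) = w} = 1 / 2 := by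
  rw [measureReal_restrict_apply' measurableSet_Icc]
  obtain rfl | rfl : w = 0 ∨ w = 1 := by omega
  · have hset : {x : ℝ | (if 1 / 2 ≤ x then (1 : Fin 2) else 0) = 0} ∩ Icc 0 1 =
        Ico 0 (1 / 2) := by
      ext x
      grind
    rw [hset, Real.volume_real_Ico_of_le (by norm_num), sub_zero]
  · have hset : {x : ℝ | (if 1 / 2 ≤ x then (1 : Fin 2) else 0) = 1} ∩ Icc 0 1 =
        Icc (1 / 2) 1 := by
      ext x
      grind
    rw [hset, Real.volume_real_Icc_of_le (by norm_num), sub_half]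

theorem unif_cube_real_round (v : Fin d → Fin 2) :
    (unif (Icc (0 : Fin d → ℝ) 1)).real (round ⁻¹' {v}) = (1 / 2) ^ d := by
  have hbox : round ⁻¹' {v} = univ.pi fun i => {x : ℝ | (if 1 / 2 ≤ x then 1 else 0) = v i} := by
    ext x
    simp [round, funext_iff]
  rw [unif_cube, hbox, measureReal_def, Measure.pi_pi, ENNReal.toReal_prod]
  simp only [← measureReal_def, restrict_Icc_real_half_le_bit, Finset.prod_const,
    Finset.card_univ, Fintype.card_fin]

theorem quarter_pow_le_conv_unif_cube_real_round (hb : 0 ≤ b) (v : Fin d → Fin 2) :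
    (1 / 4 : ℝ) ^ d ≤ (unif (Icc (0 : Fin d → ℝ) 1) ∗ laplaceVec d b).real (round ⁻¹' {v}) := by
  calc (1 / 4 : ℝ) ^ d
      = (1 - exp (-0) / 2) ^ d * (unif (Icc (0 : Fin d → ℝ) 1)).real (round ⁻¹' {v}) := by
        rw [unif_cube_real_round, ← mul_pow]
        norm_num
    _ ≤ (unif (Icc (0 : Fin d → ℝ) 1) ∗ laplaceVec d b).real (round ⁻¹' {v}) :=
        pow_mul_le_conv_laplaceVec_real_round hb le_rfl (fun _ hx => hx) fun _ _ _ => by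
          simp only [mul_zero, abs_nonneg]

end Cube

section Mechanism

variable {X : Type*} {d : ℕ} (binMap : Index d ≃ (Fin d → Fin 2)) {b ε δ : ℝ}

/-- The noise scale `2Δ/ε` of binary embedding purification. -/
noncomputable def noiseScale (d : ℕ) (ε δ : ℝ) : ℝ :=
  2 * noiseBound d 1 ((d : ℝ) / 2) δ ((2 : ℝ) ^ d)⁻¹ / ε

/-- The law of the index decoded from `x + y`, where `x` has law `μ` and the coordinates of `y`
are independent Laplace variables of scale `b`: the last two steps of the algorithm. -/
noncomputable def noisyDecode (b : ℝ) (μ : Measure (Fin d → ℝ)) : Measure (Index d) :=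
  (μ ∗ laplaceVec d b).map fun z => binMap.symm (round z)

theorem measurable_symm_round : Measurable fun z : Fin d → ℝ => binMap.symm (round z) :=
  (Measurable.of_discrete (f := binMap.symm)).comp measurable_round

instance isProbabilityMeasure_noisyDecode (b : ℝ) (μ : Measure (Fin d → ℝ))
    [IsProbabilityMeasure μ] : IsProbabilityMeasure (noisyDecode binMap b μ) :=
  Measure.isProbabilityMeasure_map (measurable_symm_round binMap).aemeasurable

theorem noisyDecode_real_singleton (b : ℝ) (μ : Measure (Fin d → ℝ)) (w : Index d) :
    (noisyDecode binMap b μ).real {w} = (μ ∗ laplaceVec d b).real (round ⁻¹' {binMap w}) := by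
  rw [noisyDecode, map_measureReal_apply (measurable_symm_round binMap)
    (measurableSet_singleton w)]
  congr 1
  ext z
  simp [Equiv.symm_apply_eq]

theorem quarter_pow_le_noisyDecode_unif_cube (hb : 0 ≤ b) {S : Set (Index d)}
    (hS : S.Nonempty) : (1 / 4 : ℝ) ^ d ≤ (noisyDecode binMap b (unif (Icc 0 1))).real S := by
  obtain ⟨w, hw⟩ := hS
  calc (1 / 4 : ℝ) ^ d ≤ (noisyDecode binMap b (unif (Icc 0 1))).real {w} := by
        rw [noisyDecode_real_singleton]
        exact quarter_pow_le_conv_unif_cube_real_round hb (binMap w)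
    _ ≤ (noisyDecode binMap b (unif (Icc 0 1))).real S :=
        measureReal_mono (singleton_subset_iff.2 hw)

theorem aPureDiscrete_eq_mixture (u : Index d) :
    aPureDiscrete binMap ε δ u = mixture ((2 : ℝ) ^ d)⁻¹
      (noisyDecode binMap (noiseScale d ε δ) (Measure.dirac (embed (binMap u))))
      (noisyDecode binMap (noiseScale d ε δ) (unif (Icc 0 1))) := by
  rw [noisyDecode, noisyDecode, ← map_mixture (measurable_symm_round binMap), ← mixture_conv]
  rfl

theorem inv_two_pow_le_one (d : ℕ) : ((2 : ℝ) ^ d)⁻¹ ≤ 1 :=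
  inv_le_one_of_one_le₀ (one_le_pow₀ one_le_two)

instance isProbabilityMeasure_aPureDiscrete (u : Index d) :
    IsProbabilityMeasure (aPureDiscrete binMap ε δ u) := by
  rw [aPureDiscrete_eq_mixture]
  exact isProbabilityMeasure_mixture (by positivity) (inv_two_pow_le_one d) _ _

theorem purify_eq_mixture (M : Dataset X → Measure (Index d)) (D : Dataset X)
    [IsProbabilityMeasure (M D)] :
    purify binMap ε δ M D = mixture ((2 : ℝ) ^ d)⁻¹
      ((M D).bind fun u =>
        noisyDecode binMap (noiseScale d ε δ) (Measure.dirac (embed (binMap u))))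
      (noisyDecode binMap (noiseScale d ε δ) (unif (Icc 0 1))) := by
  rw [← bind_mixture _ Measurable.of_discrete]
  exact congrArg (M D).bind (funext (aPureDiscrete_eq_mixture binMap))

theorem IsDP.purify {M : Dataset X → Measure (Index d)} (hM : IsDP M ε δ) (hδ : 0 ≤ δ)
    (hb : 0 ≤ noiseScale d ε δ) {ε' : ℝ} (hε' : 0 ≤ ε') (hεε' : ε ≤ ε')
    (hδε' : δ ≤ (exp ε' - 1) * (1 / 8) ^ d) : IsDP (purify binMap ε δ M) ε' 0 := by
  have hω : 0 ≤ ((2 : ℝ) ^ d)⁻¹ := by positivity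
  have heighth : ((2 : ℝ) ^ d)⁻¹ * (1 / 4) ^ d = (1 / 8) ^ d := by
    rw [← inv_pow, ← mul_pow]
    norm_num
  have hmix : Purification.purify binMap ε δ M = fun D => mixture ((2 : ℝ) ^ d)⁻¹
      ((M D).bind fun u =>
        noisyDecode binMap (noiseScale d ε δ) (Measure.dirac (embed (binMap u))))
      (noisyDecode binMap (noiseScale d ε δ) (unif (Icc 0 1))) := funext fun D =>
    have := hM.isProbabilityMeasure D
    purify_eq_mixture binMap M D
  rw [hmix]
  refine (hM.bind Measurable.of_discrete).mixture_pure hω (inv_two_pow_le_one d) hε' hεε'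
    (fun S _ hS => quarter_pow_le_noisyDecode_unif_cube binMap hb hS) ?_
  rw [heighth]
  exact (mul_le_of_le_one_left hδ (sub_le_self 1 hω)).trans hδε'

theorem mul_one_sub_le_aPureDiscrete_real_singleton {t : ℝ} (hb : 0 ≤ noiseScale d ε δ)
    (ht : 0 ≤ t) (h : noiseScale d ε δ * t ≤ 1 / 2) (u : Index d) :
    (1 - ((2 : ℝ) ^ d)⁻¹) * (1 - d / 2 * exp (-t)) ≤ (aPureDiscrete binMap ε δ u).real {u} := by
  have hω : ((2 : ℝ) ^ d)⁻¹ ≤ 1 := inv_two_pow_le_one d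
  rw [aPureDiscrete_eq_mixture, mixture_real_apply (by positivity) hω,
    noisyDecode_real_singleton _ _ (Measure.dirac _)]
  refine le_add_of_le_of_nonneg ?_ (by positivity)
  exact mul_le_mul_of_nonneg_left (one_sub_le_conv_dirac_embed_real_round hb ht h (binMap u))
    (sub_nonneg.2 hω)

theorem le_jointLaw_real_diagonal {M : Dataset X → Measure (Index d)} {D : Dataset X}
    [IsProbabilityMeasure (M D)] {c : ℝ} (h : ∀ u, c ≤ (aPureDiscrete binMap ε δ u).real {u}) :
    c ≤ (jointLaw binMap ε δ M D).real {p | p.1 = p.2} := by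
  have (u : Index d) : IsProbabilityMeasure ((aPureDiscrete binMap ε δ u).map fun v => (u, v)) :=
    Measure.isProbabilityMeasure_map Measurable.of_discrete.aemeasurable
  refine le_measureReal_bind Measurable.of_discrete MeasurableSet.of_discrete fun u => ?_
  have hpre : (fun v => (u, v)) ⁻¹' {p : Index d × Index d | p.1 = p.2} = {u} := by
    ext v
    simp [eq_comm]
  rw [map_measureReal_apply Measurable.of_discrete MeasurableSet.of_discrete, hpre]
  exact h u

end Mechanism

section Calibration

variable {d : ℕ} {ε δ : ℝ}

theorem pow_div_factorial_le_exp_sub_one {x : ℝ} (hx : 0 ≤ x) (hd : 1 ≤ d) :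
    x ^ d / d.factorial ≤ exp x - 1 := by
  have hone : (1 : ℝ) ≤ ∑ i ∈ Finset.range d, x ^ i / i.factorial :=
    le_trans (by simp) (Finset.single_le_sum (f := fun i : ℕ => x ^ i / (i.factorial : ℝ))
      (fun i _ => by positivity) (Finset.mem_range.2 hd))
  have hsum := sum_le_exp_of_nonneg hx (d + 1)
  rw [Finset.sum_range_succ] at hsum
  linarith

theorem two_mul_div_pow_le_exp_sub_one_mul (hd : 1 ≤ d) (hε : 0 ≤ ε) :
    2 * (ε / (8 * (d : ℝ) ^ 2)) ^ d ≤ (exp (2 * ε) - 1) * (1 / 8) ^ d := by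
  have hd1 : (1 : ℝ) ≤ d := by exact_mod_cast hd
  have hfac : (d.factorial : ℝ) ≤ ((d : ℝ) ^ 2) ^ d :=
    calc (d.factorial : ℝ) ≤ (d : ℝ) ^ d := by exact_mod_cast Nat.factorial_le_pow d
      _ ≤ ((d : ℝ) ^ 2) ^ d := by
        gcongr
        exact le_self_pow₀ hd1 two_ne_zero
  have htwo : (2 : ℝ) ≤ 2 ^ d := le_self_pow₀ one_le_two (Nat.one_le_iff_ne_zero.1 hd)
  calc 2 * (ε / (8 * (d : ℝ) ^ 2)) ^ d = 2 * (ε ^ d / ((d : ℝ) ^ 2) ^ d) * (1 / 8) ^ d := by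
        simp only [div_pow, mul_pow, one_pow]
        ring
    _ ≤ 2 ^ d * (ε ^ d / d.factorial) * (1 / 8) ^ d := by gcongr
    _ = (2 * ε) ^ d / d.factorial * (1 / 8) ^ d := by
        rw [mul_pow]
        ring
    _ ≤ (exp (2 * ε) - 1) * (1 / 8) ^ d := by
        gcongr
        exact pow_div_factorial_le_exp_sub_one (by positivity) hd

theorem noiseScale_eq (d : ℕ) (ε δ : ℝ) :
    noiseScale d ε δ = 2 * (d * (δ * 2 ^ d / 2) ^ (1 / (d : ℝ))) / ε := by
  have h : δ / (2 * ((2 : ℝ) ^ d)⁻¹) = δ * 2 ^ d / 2 := by field_simp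
  rw [noiseScale, noiseBound, h, div_one, sub_self, rpow_zero]
  ring

theorem noiseScale_nonneg (d : ℕ) (hε : 0 ≤ ε) (hδ : 0 ≤ δ) : 0 ≤ noiseScale d ε δ := by
  rw [noiseScale_eq]
  positivity

theorem noiseScale_mul_le_half_iff (hd : 1 ≤ d) (hε : 0 < ε) (hδ : 0 ≤ δ) :
    noiseScale d ε δ * d ≤ 1 / 2 ↔ δ ≤ 2 * (ε / (8 * (d : ℝ) ^ 2)) ^ d := by
  have hd0 : (0 : ℝ) < d := by exact_mod_cast hd
  have hscale (r : ℝ) : 2 * (d * r) / ε * d ≤ 1 / 2 ↔ r ≤ ε / (4 * (d : ℝ) ^ 2) := by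
    rw [div_mul_eq_mul_div, div_le_iff₀ hε, le_div_iff₀ (by positivity)]
    constructor <;> intro h <;> linarith
  have hpow : (ε / (4 * (d : ℝ) ^ 2)) ^ d = 2 ^ d * (ε / (8 * (d : ℝ) ^ 2)) ^ d := by
    rw [← mul_pow]
    congr 1
    ring
  rw [noiseScale_eq, hscale, one_div,
    rpow_inv_le_iff_of_pos (by positivity) (by positivity) hd0, rpow_natCast, hpow,
    div_le_iff₀ two_pos, mul_comm δ, mul_assoc, mul_le_mul_iff_right₀ (by positivity),
    mul_comm _ (2 : ℝ)]

theorem pow_div_two_mul_pow_le (hd : 1 ≤ d) (hε : 0 ≤ ε) :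
    ε ^ d / (2 * (d : ℝ)) ^ (3 * d) ≤ 2 * (ε / (8 * (d : ℝ) ^ 2)) ^ d := by
  have hd1 : (1 : ℝ) ≤ d := by exact_mod_cast hd
  calc ε ^ d / (2 * (d : ℝ)) ^ (3 * d) = (ε / (8 * (d : ℝ) ^ 3)) ^ d := by
        rw [div_pow, pow_mul]
        congr 2
        ring
    _ ≤ (ε / (8 * (d : ℝ) ^ 2)) ^ d := by
        gcongr
        norm_num
    _ ≤ 2 * (ε / (8 * (d : ℝ) ^ 2)) ^ d := le_mul_of_one_le_left (by positivity) one_le_two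

end Calibration

end Purification

open Purification in
theorem theorem2_general {X : Type*} (d : ℕ) (hd : 1 ≤ d) (ε δ : ℝ) (hε : 0 < ε) (hδ : 0 ≤ δ)
    (hδε : δ ≤ 2 * (ε / (8 * (d : ℝ) ^ 2)) ^ d)
    (binMap : Index d ≃ (Fin d → Fin 2)) (M : Dataset X → Measure (Index d))
    (hM : IsDP M ε δ) :
    IsDP (purify binMap ε δ M) (2 * ε) 0 ∧
    ∀ D : Dataset X, (jointLaw binMap ε δ M D).real {p | p.1 = p.2} >
      1 - ((2 : ℝ) ^ d)⁻¹ - (d : ℝ) / 2 * Real.exp (-(d : ℝ)) := by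
  have hb : 0 ≤ noiseScale d ε δ := noiseScale_nonneg d hε.le hδ
  refine ⟨hM.purify binMap hδ hb (by linarith) (by linarith)
    (hδε.trans (two_mul_div_pow_le_exp_sub_one_mul hd hε.le)), fun D => ?_⟩
  have := hM.isProbabilityMeasure D
  have hscale : noiseScale d ε δ * d ≤ 1 / 2 := (noiseScale_mul_le_half_iff hd hε hδ).2 hδε
  have hgain : 0 < ((2 : ℝ) ^ d)⁻¹ * ((d : ℝ) / 2 * Real.exp (-(d : ℝ))) := by positivity
  calc 1 - ((2 : ℝ) ^ d)⁻¹ - (d : ℝ) / 2 * Real.exp (-(d : ℝ))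
      < (1 - ((2 : ℝ) ^ d)⁻¹) * (1 - (d : ℝ) / 2 * Real.exp (-(d : ℝ))) := by linarith
    _ ≤ (jointLaw binMap ε δ M D).real {p | p.1 = p.2} :=
      le_jointLaw_real_diagonal binMap <|
        mul_one_sub_le_aPureDiscrete_real_singleton binMap hb d.cast_nonneg hscale

theorem theorem2 {X : Type*} (d : ℕ) (hd : 1 ≤ d) (ε δ : ℝ) (hε : 0 < ε) (hδ : 0 ≤ δ)
    (hδε : δ < ε ^ d / (2 * (d : ℝ)) ^ (3 * d))
    (binMap : Purification.Index d ≃ (Fin d → Fin 2))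
    (M : Purification.Dataset X → MeasureTheory.Measure (Purification.Index d))
    (hM : Purification.IsDP M ε δ) :
    Purification.IsDP (Purification.purify binMap ε δ M) (2 * ε) 0 ∧
    ∀ D : Purification.Dataset X,
      (Purification.jointLaw binMap ε δ M D).real {p | p.1 = p.2} >
        1 - ((2 : ℝ) ^ d)⁻¹ - (d : ℝ) / 2 * Real.exp (-(d : ℝ)) := by
  exact theorem2_general d hd ε δ hε hδ
    (hδε.le.trans (Purification.pow_div_two_mul_pow_le hd hε.le)) binMap M hM
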